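/- Let $a, b\in\mathbf{Q}^*$ be multiplicatively independent, i.e. $a^xb^y=1$ with $x,y\in\mathbf{Z}$ only for $x=y=0$. Let $t$ be the order of the torsion subgroup of $\mathbf{Q}^*/\langle -1,a,b\rangle$, and let $s$ be the product of the primes $p$ for which $\mathrm{ord}_p(a)$ and $\mathrm{ord}_p(b)$ are not both equal to $0$. For positive integers $i,j$ put $$f_{i,j}=\frac{i^2 j\,\varphi(ij)}{[\mathbf{Q}(\zeta_{ij},a^{1/ij},b^{1/i}):\mathbf{Q}]},$$ where $\varphi$ is Euler's function and $\zeta_{ij}$ is a primitive $ij$-th root of unity. Then $f_{i,j}$ is an integer that, for fixed $a$ and $b$, depends only on $\gcd(i,2t)$ and $\gcd(ij,8st)$; that is, there is a function $g=g_{a,b}$ with non-negative integer values such that $f_{i,j}=g(\gcd(i,2t),\gcd(ij,8st))$ for all positive integers $i,j$. -/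

import Mathlib

namespace TwoVariableArtin

/-- `a` and `b` are multiplicatively independent in `ℚ^*`. -/
def MultIndep (a b : ℚˣ) : Prop :=
  ∀ x y : ℤ, a ^ x * b ^ y = 1 → x = 0 ∧ y = 0

/-- The subgroup `⟨-1, a, b⟩` of `ℚ^*`. -/
def signedSpan (a b : ℚˣ) : Subgroup ℚˣ :=
  Subgroup.closure {-1, a, b}

/-- The order `t` of the torsion subgroup of `ℚ^* / ⟨-1, a, b⟩`. -/
noncomputable def torsionOrder (a b : ℚˣ) : ℕ :=
  Nat.card (CommGroup.torsion (ℚˣ ⧸ signedSpan a b))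

/-- The primes at which the valuations of `a` and `b` are not both zero. -/
def badPrimes (a b : ℚˣ) : Set ℕ :=
  {p | p.Prime ∧ ¬ (padicValRat p (a : ℚ) = 0 ∧ padicValRat p (b : ℚ) = 0)}

theorem padicValRat_eq_zero_of_not_dvd {p : ℕ} {q : ℚ}
    (h : ¬ p ∣ q.num.natAbs * q.den) : padicValRat p q = 0 := by
  have h1 : ¬ p ∣ q.num.natAbs := fun h' => h (h'.mul_right _)
  have h2 : ¬ p ∣ q.den := fun h' => h (h'.mul_left _)
  simp [padicValRat, padicValInt, padicValNat.eq_zero_of_not_dvd h1,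
    padicValNat.eq_zero_of_not_dvd h2]

/-- The product defining `s` is a finite one. -/
theorem badPrimes_finite (a b : ℚˣ) : (badPrimes a b).Finite := by
  have hne : ∀ q : ℚˣ, (q : ℚ).num.natAbs * (q : ℚ).den ≠ 0 := fun q =>
    mul_ne_zero (by simp) (q : ℚ).den_nz
  refine Set.Finite.subset (Finset.finite_toSet
    (((a : ℚ).num.natAbs * (a : ℚ).den).primeFactors ∪
      ((b : ℚ).num.natAbs * (b : ℚ).den).primeFactors)) ?_
  rintro p ⟨hp, hab⟩
  rw [Finset.mem_coe, Finset.mem_union, Nat.mem_primeFactors, Nat.mem_primeFactors]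
  by_contra hcon
  rw [not_or] at hcon
  exact hab ⟨padicValRat_eq_zero_of_not_dvd fun h => hcon.1 ⟨hp, h, hne a⟩,
    padicValRat_eq_zero_of_not_dvd fun h => hcon.2 ⟨hp, h, hne b⟩⟩

/-- The product `s` of the primes at which the valuations of `a` and `b` are not both zero. -/
noncomputable def badPrimesProd (a b : ℚˣ) : ℕ :=
  ∏ p ∈ (badPrimes_finite a b).toFinset, p

/-- The field `F_{i,j} = ℚ(ζ_{ij}, a^{1/ij}, b^{1/i})`. For positive `i` and `j`, adjoining all
the roots is the same as adjoining a primitive `ij`-th root of unity, one `ij`-th root of `a` and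
one `i`-th root of `b`, whatever the choice of these. -/
noncomputable def radicalField (a b : ℚˣ) (i j : ℕ) :
    IntermediateField ℚ (AlgebraicClosure ℚ) :=
  IntermediateField.adjoin ℚ
    ({z | z ^ (i * j) = 1} ∪
      {z | z ^ (i * j) = algebraMap ℚ (AlgebraicClosure ℚ) (a : ℚ)} ∪
      {z | z ^ i = algebraMap ℚ (AlgebraicClosure ℚ) (b : ℚ)})

/-- The degree loss `f_{i,j} = i² j φ(ij) / [F_{i,j} : ℚ]`, a priori a rational number. -/
noncomputable def degreeLoss (a b : ℚˣ) (i j : ℕ) : ℚ :=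
  ((i : ℚ) ^ 2 * (j : ℚ) * (Nat.totient (i * j) : ℚ)) /
    (Module.finrank ℚ (radicalField a b i j) : ℚ)

end TwoVariableArtin

/-! Put `n = ij`. By Kummer theory over `ℚ(ζ_n)`, the degree of the radical field is `φ(n)` times
the index in `ℤ²` of the lattice `L_{i,j}` of exponents `(x, y)` for which `a^x b^(jy)` is an `n`-th
power in `ℚ(ζ_n)` (`finrank_adjoin_radicals`). Hence `f_{i,j} = i²j / [ℤ² : L_{i,j}]`, an integer
because `L_{i,j}` contains `nℤ × iℤ`.

Let `I = gcd(i, 2t)`, `N = gcd(n, 8st)`, `J = N / I`, `m₁ = n / N`, `m₂ = i / I`. The core is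
`L_{i,j} = diag(m₁, m₂) L_{I,J}` (`radicalLattice_eq_map`): the index and `i²j` are then both
multiplied by `m₁m₂`, so `f_{i,j} = f_{I,J}`.

That `diag(m₁, m₂)` divides `L_{i,j}` comes from complex conjugation: if a rational `q` is an `n`-th
power in `ℚ(ζ_n)`, then `q²` is an `n`-th power in `ℚ` (`exists_pow_eq_sq_of_pow_eq`), and the
definition of `t` bounds the denominators (`dvd_of_mem_radicalLattice`). That the quotient vector
lies in `L_{I,J}` (`mem_radicalLattice_of_scaled_mem`) uses that a positive rational supported on
the primes dividing `s` has its square root in `ℚ(ζ_{8s})`, and that `ℚ(ζ_m) ∩ ℚ(ζ_n) =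
ℚ(ζ_{gcd(m,n)})`. -/

namespace TwoVariableArtin

open IntermediateField

/-! ### Cyclotomic fields: intersections, powers, square roots of primes -/

section CyclotomicSubfield

variable (k Ω : Type*) [Field k] [Field Ω] [Algebra k Ω]

/-- The field generated over `k` by the `n`-th roots of unity of `Ω`. -/
def cyclotomicSubfield (n : ℕ) : IntermediateField k Ω :=
  adjoin k {z | z ^ n = 1}

variable {k Ω}


theorem mem_cyclotomicSubfield {n : ℕ} {z : Ω} (hz : z ^ n = 1) :
    z ∈ cyclotomicSubfield k Ω n :=
  subset_adjoin _ _ hz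

theorem cyclotomicSubfield_mono {m n : ℕ} (h : m ∣ n) :
    cyclotomicSubfield k Ω m ≤ cyclotomicSubfield k Ω n := by
  refine adjoin.mono _ _ _ fun z (hz : z ^ m = 1) => ?_
  obtain ⟨d, rfl⟩ := h
  simp [pow_mul, hz]

variable [CharZero Ω] [IsAlgClosed Ω]

instance isCyclotomicExtension_cyclotomicSubfield (n : ℕ) [NeZero n] :
    IsCyclotomicExtension {n} k (cyclotomicSubfield k Ω n) := by
  obtain ⟨ζ, hζ⟩ := HasEnoughRootsOfUnity.exists_primitiveRoot Ω n
  rw [IntermediateField.isCyclotomicExtension_singleton_iff_eq_adjoin n k Ω _ hζ]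
  refine le_antisymm (adjoin_le_iff.2 fun z (hz : z ^ n = 1) => ?_)
    (adjoin_le_iff.2 fun z hz => ?_)
  · obtain ⟨d, -, rfl⟩ := hζ.eq_pow_of_pow_eq_one hz
    exact pow_mem (mem_adjoin_simple_self k ζ) d
  · rw [Set.mem_singleton_iff.1 hz]
    exact mem_cyclotomicSubfield hζ.pow_eq_one

theorem finrank_cyclotomicSubfield (hirr : ∀ n, 0 < n → Irreducible (Polynomial.cyclotomic n k))
    (n : ℕ) [NeZero n] :
    Module.finrank k (cyclotomicSubfield k Ω n) = n.totient :=
  IsCyclotomicExtension.finrank _ (hirr n (NeZero.pos n))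

theorem index_fixingSubgroup_cyclotomicSubfield [IsGalois k Ω]
    (hirr : ∀ n, 0 < n → Irreducible (Polynomial.cyclotomic n k))
    (n : ℕ) [NeZero n] :
    (cyclotomicSubfield k Ω n).fixingSubgroup.index = n.totient := by
  rw [← finrank_eq_fixingSubgroup_index, finrank_cyclotomicSubfield hirr]

theorem cyclotomicSubfield_sup (m n : ℕ) [NeZero m] [NeZero n] :
    cyclotomicSubfield k Ω m ⊔ cyclotomicSubfield k Ω n = cyclotomicSubfield k Ω (m.lcm n) := by
  have : NeZero (m.lcm n) := ⟨Nat.lcm_ne_zero (NeZero.ne _) (NeZero.ne _)⟩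
  have := isCyclotomicExtension_lcm_sup k Ω m n
    (cyclotomicSubfield k Ω m) (cyclotomicSubfield k Ω n)
  exact isCyclotomicExtension_eq {m.lcm n} k Ω _ _

theorem totient_lcm_mul_totient_gcd (m n : ℕ) (hm : 0 < m) :
    (m.lcm n).totient * (m.gcd n).totient = m.totient * n.totient := by
  have h1 := Nat.totient_gcd_mul_totient_mul m n
  have h2 := Nat.totient_gcd_mul_totient_mul (m.gcd n) (m.lcm n)
  have hg : 0 < m.gcd n := Nat.gcd_pos_of_pos_left _ hm
  rw [Nat.gcd_mul_lcm, Nat.gcd_eq_left ((Nat.gcd_dvd_left m n).trans (Nat.dvd_lcm_left m n)),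
    h1] at h2
  exact Nat.eq_of_mul_eq_mul_right hg (by rw [h2]; ring)

theorem index_inf_mul_index_sup {G : Type*} [Group G] (H K : Subgroup G) [H.Normal] :
    (H ⊓ K).index * (H ⊔ K).index = H.index * K.index := by
  rw [← Subgroup.relIndex_mul_index (inf_le_right : H ⊓ K ≤ K), Subgroup.inf_relIndex_right,
    ← Subgroup.relIndex_sup_left, ← Subgroup.relIndex_mul_index (le_sup_left : H ≤ H ⊔ K)]
  ring

/-- Index count: `φ(lcm) φ(gcd) = φ(m) φ(n)` forces the join of the two fixing subgroups to have
index `φ(gcd)`, so it is all of the fixing subgroup of the `gcd`-th field. -/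
theorem cyclotomicSubfield_inf [IsGalois k Ω]
    (hirr : ∀ n, 0 < n → Irreducible (Polynomial.cyclotomic n k))
    (m n : ℕ) (hm : 0 < m) (hn : 0 < n) :
    cyclotomicSubfield k Ω m ⊓ cyclotomicSubfield k Ω n = cyclotomicSubfield k Ω (m.gcd n) := by
  have : NeZero m := ⟨hm.ne'⟩
  have : NeZero n := ⟨hn.ne'⟩
  have : NeZero (m.lcm n) := ⟨Nat.lcm_ne_zero (NeZero.ne _) (NeZero.ne _)⟩
  have : NeZero (m.gcd n) := ⟨(Nat.gcd_pos_of_pos_left _ hm).ne'⟩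
  refine le_antisymm ?_ (le_inf (cyclotomicSubfield_mono (Nat.gcd_dvd_left m n))
    (cyclotomicSubfield_mono (Nat.gcd_dvd_right m n)))
  have : IsGalois k (cyclotomicSubfield k Ω m) := IsCyclotomicExtension.isGalois {m} k _
  have hle : (cyclotomicSubfield k Ω m).fixingSubgroup ⊔
      (cyclotomicSubfield k Ω n).fixingSubgroup ≤
      (cyclotomicSubfield k Ω (m.gcd n)).fixingSubgroup :=
    sup_le (fixingSubgroup_antitone (cyclotomicSubfield_mono (Nat.gcd_dvd_left m n)))
      (fixingSubgroup_antitone (cyclotomicSubfield_mono (Nat.gcd_dvd_right m n)))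
  have hidx := index_inf_mul_index_sup (cyclotomicSubfield k Ω m).fixingSubgroup
    (cyclotomicSubfield k Ω n).fixingSubgroup
  rw [← fixingSubgroup_sup, cyclotomicSubfield_sup] at hidx
  simp only [index_fixingSubgroup_cyclotomicSubfield hirr] at hidx
  rw [← totient_lcm_mul_totient_gcd m n hm] at hidx
  have hpos : 0 < (m.lcm n).totient := Nat.totient_pos.2 (NeZero.pos _)
  have hgpos : 0 < (m.gcd n).totient := Nat.totient_pos.2 (NeZero.pos _)
  have hsup := Nat.eq_of_mul_eq_mul_left hpos hidx
  have hrel := Subgroup.relIndex_mul_index hle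
  rw [hsup, index_fixingSubgroup_cyclotomicSubfield hirr] at hrel
  have hone := Nat.eq_of_mul_eq_mul_right hgpos (hrel.trans (one_mul _).symm)
  rw [Subgroup.relIndex_eq_one] at hone
  rintro x ⟨hx1, hx2⟩
  rw [← InfiniteGalois.fixedField_fixingSubgroup (cyclotomicSubfield k Ω (m.gcd n))]
  rintro ⟨σ, hσ⟩
  have hmem := hone hσ
  have hsub : (cyclotomicSubfield k Ω m).fixingSubgroup ⊔
      (cyclotomicSubfield k Ω n).fixingSubgroup ≤
      MulAction.stabilizer Gal(Ω/k) x :=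
    sup_le (fun τ hτ => hτ ⟨x, hx1⟩) (fun τ hτ => hτ ⟨x, hx2⟩)
  exact hsub hmem

/-- An element of `k` that is an `n`-th power in the `n`-th cyclotomic field has a square that
is an `n`-th power of an element of `k`. -/
theorem exists_pow_eq_sq_of_pow_eq (hirr : ∀ n, 0 < n → Irreducible (Polynomial.cyclotomic n k))
    {n : ℕ} (hn : 0 < n) {q : k} (hq : q ≠ 0)
    {z : Ω} (hz : z ∈ cyclotomicSubfield k Ω n)
    (hzq : z ^ n = algebraMap k Ω q) :
    ∃ c : k, c ^ n = q ^ 2 := by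
  have : NeZero n := ⟨hn.ne'⟩
  have : IsAbelianGalois k (cyclotomicSubfield k Ω n) :=
    IsCyclotomicExtension.isAbelianGalois {n} k _
  have : FiniteDimensional k (cyclotomicSubfield k Ω n) :=
    IsCyclotomicExtension.finite_of_singleton n k _
  have hζ := IsCyclotomicExtension.zeta_spec n k (cyclotomicSubfield k Ω n)
  set ζ := IsCyclotomicExtension.zeta n k (cyclotomicSubfield k Ω n)
  -- `τ` plays the role of complex conjugation, and `w * τ w` that of `|w|²`.
  let τ := IsCyclotomicExtension.fromZetaAut hζ.inv
    (hirr n (NeZero.pos n))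
  have hτζ : τ ζ = ζ⁻¹ := IsCyclotomicExtension.fromZetaAut_spec _ _
  have hτ : ∀ ξ : cyclotomicSubfield k Ω n, ξ ^ n = 1 → ξ * τ ξ = 1 := by
    intro ξ hξ
    obtain ⟨d, -, rfl⟩ := hζ.eq_pow_of_pow_eq_one hξ
    rw [map_pow, hτζ, ← mul_pow, mul_inv_cancel₀ (hζ.ne_zero hn.ne'), one_pow]
  set w : cyclotomicSubfield k Ω n := ⟨z, hz⟩
  have hw : w ^ n = algebraMap k _ q := Subtype.ext hzq
  have hq' : algebraMap k (cyclotomicSubfield k Ω n) q ≠ 0 := by simpa using hq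
  have hw0 : w ≠ 0 := by
    rintro h
    rw [h, zero_pow hn.ne'] at hw
    exact hq' hw.symm
  -- `σ w = ξ w` with `ξ ^ n = 1`; since the Galois group is abelian, `σ` multiplies `w * τ w` by `ξ
  -- * τ ξ = 1`.
  have hfix : ∀ σ : cyclotomicSubfield k Ω n ≃ₐ[k] cyclotomicSubfield k Ω n,
      σ (w * τ w) = w * τ w := by
    intro σ
    have hξ : (σ w / w) ^ n = 1 := by
      rw [div_pow, ← map_pow, hw, AlgEquiv.commutes, div_self hq']
    have hcomm : σ (τ w) = τ (σ w) := DFunLike.congr_fun (mul_comm' σ τ) w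
    have hσ : σ w = σ w / w * w := (div_mul_cancel₀ _ hw0).symm
    rw [map_mul, hcomm, hσ, map_mul]
    linear_combination (w * τ w) * hτ _ hξ
  obtain ⟨c, hc⟩ := (IsGalois.mem_range_algebraMap_iff_fixed (F := k) _).2 hfix
  refine ⟨c, (algebraMap k (cyclotomicSubfield k Ω n)).injective ?_⟩
  rw [map_pow, hc, mul_pow, ← map_pow τ, hw, AlgEquiv.commutes, map_pow, sq]

/-- For `p = 2` the root is `ζ₈ + ζ₈⁻¹`. For odd `p` the quadratic Gauss sum has square `χ(-1) p`,
and a factor `√-1` corrects the sign. -/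
theorem exists_sq_eq_natCast_of_prime {p : ℕ} (hp : p.Prime) :
    ∃ w ∈ cyclotomicSubfield k Ω (8 * p), w ^ 2 = (p : Ω) := by
  rcases eq_or_ne p 2 with rfl | hp2
  · obtain ⟨ζ, hζ⟩ := HasEnoughRootsOfUnity.exists_primitiveRoot Ω 8
    have h4 : ζ ^ 4 = -1 :=
      (hζ.pow (by norm_num) (show 8 = 4 * 2 by norm_num)).eq_neg_one_of_two_right
    refine ⟨ζ - ζ ^ 3, ?_, ?_⟩
    · have hmem : ζ ∈ cyclotomicSubfield k Ω (8 * 2) :=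
        cyclotomicSubfield_mono (Dvd.intro _ rfl) (mem_cyclotomicSubfield hζ.pow_eq_one)
      exact sub_mem hmem (pow_mem hmem 3)
    · push_cast
      linear_combination (ζ ^ 2 - 2) * h4
  · have : Fact p.Prime := ⟨hp⟩
    have : NeZero p := ⟨hp.ne_zero⟩
    obtain ⟨ζ, hζ⟩ := HasEnoughRootsOfUnity.exists_primitiveRoot Ω p
    obtain ⟨ι, hι⟩ := HasEnoughRootsOfUnity.exists_primitiveRoot Ω 4
    have hι2 : ι ^ 2 = -1 :=
      (hι.pow (by norm_num) (show 4 = 2 * 2 by norm_num)).eq_neg_one_of_two_right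
    have hring : ringChar (ZMod p) ≠ 2 := by rwa [ZMod.ringChar_zmod_n]
    let χ : MulChar (ZMod p) Ω :=
      (quadraticChar (ZMod p)).ringHomComp (Int.castRingHom _)
    have hχ1 : χ ≠ 1 := by
      refine (MulChar.ringHomComp_ne_one_iff (RingHom.injective_int _)).2
        (quadraticChar_ne_one hring)
    have hχ2 : χ.IsQuadratic := (quadraticChar_isQuadratic (ZMod p)).comp _
    have hψ := AddChar.zmodChar_primitive_of_primitive_root p hζ
    have hsq := gaussSum_sq hχ1 hχ2 hψ
    rw [ZMod.card] at hsq
    set γ := gaussSum χ (AddChar.zmodChar p hζ.pow_eq_one)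
    have hζmem : ζ ∈ cyclotomicSubfield k Ω (8 * p) :=
      cyclotomicSubfield_mono (Dvd.intro_left _ rfl) (mem_cyclotomicSubfield hζ.pow_eq_one)
    have hιmem : ι ∈ cyclotomicSubfield k Ω (8 * p) :=
      cyclotomicSubfield_mono (Dvd.intro (2 * p) (by ring)) (mem_cyclotomicSubfield hι.pow_eq_one)
    have hγmem : γ ∈ cyclotomicSubfield k Ω (8 * p) := by
      refine sum_mem fun x _ => mul_mem ?_ ?_
      · exact intCast_mem _ _
      · rw [AddChar.zmodChar_apply]
        exact pow_mem hζmem _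
    have hχneg : χ (-1) = 1 ∨ χ (-1) = -1 := by
      rcases hχ2 (-1) with h | h | h
      · have := (isUnit_one.neg.map χ : IsUnit (χ (-1)))
        exact absurd h this.ne_zero
      · exact .inl h
      · exact .inr h
    rcases hχneg with h | h
    · exact ⟨γ, hγmem, by rw [hsq, h, one_mul]⟩
    · exact ⟨ι * γ, mul_mem hιmem hγmem, by rw [mul_pow, hsq, h, hι2]; ring⟩

end CyclotomicSubfield

/-! ### Kummer theory -/

section Kummer

/-- Duality: `Q` embeds in the dual of `R`, so `|Q| ≤ |R| ≤ |Hom(Q, Ωˣ)| = |Q|`. -/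
theorem card_eq_of_separating {Q Ω : Type*} [CommGroup Q] [Finite Q] [Field Ω] [CharZero Ω]
    [IsAlgClosed Ω] (R : Subgroup (Q →* Ωˣ)) (hR : ∀ q : Q, (∀ φ ∈ R, φ q = 1) → q = 1) :
    Nat.card R = Nat.card Q := by
  have hcard := CommGroup.card_monoidHom_of_hasEnoughRootsOfUnity Q Ω
  have : Finite (Q →* Ωˣ) := Nat.finite_of_card_ne_zero (hcard ▸ Nat.card_pos.ne')
  refine le_antisymm (hcard ▸ Subgroup.card_le_card_group R) ?_
  have hcardR := CommGroup.card_monoidHom_of_hasEnoughRootsOfUnity R Ω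
  have : Finite (R →* Ωˣ) := Nat.finite_of_card_ne_zero (hcardR ▸ Nat.card_pos.ne')
  rw [← hcardR]
  let ev : Q →* (R →* Ωˣ) := MonoidHom.flip R.subtype
  refine Nat.card_le_card_of_injective ev ((injective_iff_map_eq_one ev).2 fun q hq => ?_)
  exact hR q fun φ hφ => DFunLike.congr_fun hq ⟨φ, hφ⟩

/-- Kummer theory: the degree of a field generated over `K` by a group of `n`-th roots of elements
of `K` is the index of the subgroup of those that lie in `K`, if `K` contains the `n`-th roots of
unity. -/
theorem finrank_adjoin_range_eq_index {K Ω A : Type*} [Field K] [Field Ω] [Algebra K Ω]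
    [CharZero Ω] [IsAlgClosed Ω] [IsGalois K Ω] [CommGroup A] {n : ℕ}
    (hμ : ∀ z : Ω, z ^ n = 1 → z ∈ (algebraMap K Ω).range) (ψ : A →* Ωˣ)
    (hψ : ∀ a, (ψ a : Ω) ^ n ∈ (algebraMap K Ω).range) (H : Subgroup A) [H.FiniteIndex]
    (hH : ∀ a, a ∈ H ↔ (ψ a : Ω) ∈ (algebraMap K Ω).range) :
    Module.finrank K (adjoin K (Set.range fun a => (ψ a : Ω))) = H.index := by
  let act : Gal(Ω/K) → Ωˣ →* Ωˣ := fun σ => Units.map (σ : Ω →* Ω)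
  have hact : ∀ σ u, (act σ u : Ω) = σ u := fun _ _ => rfl
  -- The Kummer pairing. Its values are `n`-th roots of unity, hence fixed by Galois, which makes it
  -- multiplicative in `σ`. Its kernel in `σ` is the fixing subgroup of the extension, and its image
  -- separates the points of `A ⧸ H`.
  let χ₀ : Gal(Ω/K) → A →* Ωˣ := fun σ => (act σ).comp ψ / ψ
  have hχ₀ : ∀ σ a, χ₀ σ a = act σ (ψ a) / ψ a := fun _ _ => rfl
  have hfix : ∀ (σ τ : Gal(Ω/K)) a, act σ (χ₀ τ a) = χ₀ τ a := by
    intro σ τ a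
    obtain ⟨x, hx⟩ := hψ a
    obtain ⟨y, hy⟩ := hμ (χ₀ τ a : Ω) (by
      rw [hχ₀, Units.val_div_eq_div_val, hact, div_pow, ← map_pow, ← hx, AlgEquiv.commutes, hx,
        div_self (pow_ne_zero _ (Units.ne_zero _))])
    apply Units.ext
    rw [hact, ← hy, AlgEquiv.commutes]
  have hker : ∀ σ, H ≤ (χ₀ σ).ker := by
    intro σ a ha
    obtain ⟨x, hx⟩ := (hH a).1 ha
    rw [MonoidHom.mem_ker, hχ₀, div_eq_one]
    apply Units.ext
    rw [hact, ← hx, AlgEquiv.commutes]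
  let χ : Gal(Ω/K) →* (A ⧸ H →* Ωˣ) := MonoidHom.mk' (fun σ => QuotientGroup.lift H (χ₀ σ) (hker σ))
    fun σ τ => by
      ext a : 2
      have h : act (σ * τ) (ψ a) = act σ (act τ (ψ a)) := rfl
      have h2 : act τ (ψ a) = χ₀ τ a * ψ a := by rw [hχ₀, div_mul_cancel]
      change χ₀ (σ * τ) a = χ₀ σ a * χ₀ τ a
      rw [hχ₀ (σ * τ), h, h2, map_mul, hfix, hχ₀ σ, div_mul_eq_mul_div, mul_comm]
  have hχ : ∀ σ (a : A), χ σ a = χ₀ σ a := fun _ _ => rfl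
  have hχ1 : ∀ σ a, χ₀ σ a = 1 ↔ σ (ψ a : Ω) = ψ a := by
    intro σ a
    rw [hχ₀, div_eq_one, Units.ext_iff, hact]
  have hfs : (adjoin K (Set.range fun a => (ψ a : Ω))).fixingSubgroup = χ.ker := by
    ext σ
    rw [MonoidHom.mem_ker]
    constructor
    · intro hσ
      ext a : 2
      refine (hχ1 σ a).2 ?_
      exact hσ ⟨ψ a, subset_adjoin _ _ ⟨a, rfl⟩⟩
    · intro hσ
      have : adjoin K (Set.range fun a => (ψ a : Ω)) ≤ fixedField (Subgroup.zpowers σ) := by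
        rw [adjoin_le_iff]
        rintro _ ⟨a, rfl⟩
        have h1 : σ (ψ a : Ω) = ψ a := (hχ1 σ a).1 (by rw [← hχ, hσ]; rfl)
        have h2 : Subgroup.zpowers σ ≤ MulAction.stabilizer Gal(Ω/K) (ψ a : Ω) :=
          (Subgroup.zpowers_le).2 h1
        rintro ⟨τ, hτ⟩
        exact h2 hτ
      exact (le_iff_le _ _).1 this (Subgroup.mem_zpowers σ)
  rw [finrank_eq_fixingSubgroup_index, hfs, Subgroup.index_ker, Subgroup.index_eq_card]
  refine card_eq_of_separating _ fun q => ?_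
  obtain ⟨a, rfl⟩ := QuotientGroup.mk_surjective q
  intro h
  rw [QuotientGroup.eq_one_iff, hH]
  refine (InfiniteGalois.mem_range_algebraMap_iff_fixed _).2 fun σ => ?_
  exact (hχ1 σ a).1 (h _ ⟨σ, rfl⟩)

end Kummer

/-! ### The exponent lattice and the degree of the radical field -/

section RadicalLattice

variable (k Ω : Type*) [Field k] [Field Ω] [Algebra k Ω]

/-- The exponents `(x, y)` such that `a ^ x * b ^ (j * y)` is an `ij`-th power in the `ij`-th
cyclotomic field. -/
def radicalLattice (a b : kˣ) (i j : ℕ) : AddSubgroup (ℤ × ℤ) where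
  carrier := {v | ∃ z : Ωˣ, (z : Ω) ∈ cyclotomicSubfield k Ω (i * j) ∧
    z ^ (i * j) = Units.map (algebraMap k Ω : k →* Ω) (a ^ v.1 * b ^ (j * v.2))}
  zero_mem' := ⟨1, one_mem _, by simp⟩
  add_mem' := by
    rintro v w ⟨z, hz, hv⟩ ⟨z', hz', hw⟩
    refine ⟨z * z', mul_mem hz hz', ?_⟩
    rw [mul_pow, hv, hw, ← map_mul, Prod.fst_add, Prod.snd_add, mul_add, zpow_add, zpow_add,
      mul_mul_mul_comm]
  neg_mem' := by
    rintro v ⟨z, hz, hv⟩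
    refine ⟨z⁻¹, by simpa using inv_mem hz, ?_⟩
    rw [inv_pow, hv, ← map_inv, Prod.fst_neg, Prod.snd_neg, mul_neg, zpow_neg, zpow_neg,
      mul_inv]

variable {k Ω}

theorem mem_radicalLattice {a b : kˣ} {i j : ℕ} {v : ℤ × ℤ} :
    v ∈ radicalLattice k Ω a b i j ↔ ∃ z : Ωˣ, (z : Ω) ∈ cyclotomicSubfield k Ω (i * j) ∧
      z ^ (i * j) = Units.map (algebraMap k Ω : k →* Ω) (a ^ v.1 * b ^ (j * v.2)) :=
  Iff.rfl

theorem index_prod_zmultiples (m n : ℕ) :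
    ((AddSubgroup.zmultiples (m : ℤ)).prod (AddSubgroup.zmultiples (n : ℤ))).index = m * n := by
  rw [AddSubgroup.index_prod, Int.index_zmultiples, Int.index_zmultiples, Int.natAbs_natCast,
    Int.natAbs_natCast]

theorem prod_zmultiples_le_radicalLattice (a b : kˣ) (i j : ℕ) :
    (AddSubgroup.zmultiples ((i * j : ℕ) : ℤ)).prod (AddSubgroup.zmultiples (i : ℤ)) ≤
      radicalLattice k Ω a b i j := by
  rintro ⟨_, _⟩ ⟨hx, hy⟩
  obtain ⟨x, rfl⟩ := Int.mem_zmultiples_iff.1 hx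
  obtain ⟨y, rfl⟩ := Int.mem_zmultiples_iff.1 hy
  refine ⟨Units.map (algebraMap k Ω : k →* Ω) (a ^ x * b ^ y),
    IntermediateField.algebraMap_mem _ _, ?_⟩
  rw [← map_pow, mul_pow, ← zpow_natCast, ← zpow_natCast, ← zpow_mul, ← zpow_mul]
  congr 3
  · ring
  · push_cast; ring

/-- This divisibility is the integrality of `f_{i,j}`. -/
theorem index_radicalLattice_dvd (a b : kˣ) (i j : ℕ) :
    (radicalLattice k Ω a b i j).index ∣ i * j * i :=
  index_prod_zmultiples (i * j) i ▸
    AddSubgroup.index_dvd_of_le (prod_zmultiples_le_radicalLattice a b i j)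

/-- Kummer theory over the cyclotomic field `C`, applied to `(x, y) ↦ α^x β^y` with `α^(ij) = a` and
`β^i = b`, whose `ij`-th power is `a^x b^(jy)`. The choice of roots is harmless because `C` contains
the roots of unity. -/
theorem finrank_adjoin_radicals [CharZero Ω] [IsAlgClosed Ω] [IsGalois k Ω]
    (hirr : ∀ n, 0 < n → Irreducible (Polynomial.cyclotomic n k)) (a b : kˣ) {i j : ℕ}
    (hi : 0 < i) (hj : 0 < j) :
    Module.finrank k (adjoin k ({z : Ω | z ^ (i * j) = 1} ∪
      {z | z ^ (i * j) = algebraMap k Ω a} ∪ {z | z ^ i = algebraMap k Ω b})) =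
      (i * j).totient * (radicalLattice k Ω a b i j).index := by
  have hn : 0 < i * j := Nat.mul_pos hi hj
  have : NeZero (i * j) := ⟨hn.ne'⟩
  set R := adjoin k ({z : Ω | z ^ (i * j) = 1} ∪
      {z | z ^ (i * j) = algebraMap k Ω a} ∪ {z | z ^ i = algebraMap k Ω b}) with hR
  set C := cyclotomicSubfield k Ω (i * j) with hC
  have hCR : C ≤ R :=
    adjoin.mono _ _ _ fun z hz => .inl (.inl hz)
  have hlift : ∀ (u : kˣ) {m : ℕ}, 0 < m →
      ∃ w : Ωˣ, w ^ m = Units.map (algebraMap k Ω : k →* Ω) u := by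
    intro u m hm
    obtain ⟨w, hw⟩ := IsAlgClosed.exists_pow_nat_eq (algebraMap k Ω u) hm
    have hw0 : w ≠ 0 := by
      rintro rfl
      rw [zero_pow hm.ne'] at hw
      exact (map_ne_zero (algebraMap k Ω)).2 u.ne_zero hw.symm
    exact ⟨Units.mk0 w hw0, Units.ext (by simpa using hw)⟩
  obtain ⟨α, hα⟩ := hlift a hn
  obtain ⟨β, hβ⟩ := hlift b hi
  let ψ : Multiplicative (ℤ × ℤ) →* Ωˣ :=
    { toFun := fun v => α ^ v.toAdd.1 * β ^ v.toAdd.2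
      map_one' := by simp
      map_mul' := fun v w => by
        rw [toAdd_mul, Prod.fst_add, Prod.snd_add, zpow_add, zpow_add, mul_mul_mul_comm] }
  have hψ : ∀ v, ψ v = α ^ v.toAdd.1 * β ^ v.toAdd.2 := fun _ => rfl
  have hψn : ∀ v, ψ v ^ (i * j) = Units.map (algebraMap k Ω : k →* Ω)
      (a ^ v.toAdd.1 * b ^ (j * v.toAdd.2)) := by
    intro v
    rw [hψ, mul_pow, map_mul, map_zpow, map_zpow, ← hα, ← hβ]
    simp only [← zpow_natCast, ← zpow_mul]
    congr 2 <;> · push_cast; ring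
  have hmem : ∀ z : Ω, z ∈ (algebraMap C Ω).range ↔ z ∈ C := by
    intro z
    constructor
    · rintro ⟨w, rfl⟩; exact w.2
    · intro h; exact ⟨⟨z, h⟩, rfl⟩
  let H : Subgroup (Multiplicative (ℤ × ℤ)) := (radicalLattice k Ω a b i j).toSubgroup
  have hHi : H.index = (radicalLattice k Ω a b i j).index := rfl
  have : H.FiniteIndex := ⟨by
    rw [hHi]
    exact fun h => (Nat.mul_pos hn hi).ne'
      (Nat.eq_zero_of_zero_dvd (h ▸ index_radicalLattice_dvd (Ω := Ω) a b i j))⟩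
  have hμ : ∀ z : Ω, z ^ (i * j) = 1 → z ∈ C := fun z hz => mem_cyclotomicSubfield hz
  have hH : ∀ v, v ∈ H ↔ (ψ v : Ω) ∈ C := by
    intro v
    constructor
    · rintro ⟨z, hz, hv⟩
      have h1 : ((ψ v / z : Ωˣ) : Ω) ∈ C := by
        refine hμ _ ?_
        have hv' : z ^ (i * j) = Units.map (algebraMap k Ω : k →* Ω)
          (a ^ v.toAdd.1 * b ^ (j * v.toAdd.2)) := hv
        rw [← Units.val_pow_eq_pow_val, div_pow, hψn, hv', div_self', Units.val_one]
      have := mul_mem h1 hz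
      rwa [← Units.val_mul, div_mul_cancel] at this
    · intro h
      exact ⟨ψ v, h, hψn v⟩
  have key := finrank_adjoin_range_eq_index (K := C) (Ω := Ω) (n := i * j)
    (fun z hz => (hmem z).2 (hμ z hz)) ψ
    (fun v => (hmem _).2 (by
      rw [← Units.val_pow_eq_pow_val, hψn]; exact IntermediateField.algebraMap_mem C _)) H
    (fun v => (hH v).trans (hmem _).symm)
  have hαR : (α : Ω) ∈ R := subset_adjoin _ _ (.inl (.inr (by
    simpa using congrArg Units.val hα)))
  have hβR : (β : Ω) ∈ R := subset_adjoin _ _ (.inr (by simpa using congrArg Units.val hβ))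
  have hext : extendScalars hCR = adjoin C (Set.range fun v => (ψ v : Ω)) := by
    apply le_antisymm
    · rw [extendScalars_le_iff, hR, adjoin_le_iff]
      set E := adjoin C (Set.range fun v => (ψ v : Ω)) with hE
      have hCE : ∀ z ∈ C, z ∈ E := fun z hz => IntermediateField.algebraMap_mem E (⟨z, hz⟩ : C)
      have hαE : (α : Ω) ∈ E :=
        subset_adjoin _ _ ⟨Multiplicative.ofAdd (1, 0), by simp [hψ]⟩
      have hβE : (β : Ω) ∈ E :=
        subset_adjoin _ _ ⟨Multiplicative.ofAdd (0, 1), by simp [hψ]⟩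
      have haux : ∀ (z : Ω) (γ : Ωˣ) (m : ℕ), m ∣ i * j → z ^ m = ((γ ^ m : Ωˣ) : Ω) →
          (γ : Ω) ∈ E → z ∈ E := by
        intro z γ m hm hz hγ
        have h1 : z / γ ∈ C := by
          refine cyclotomicSubfield_mono hm (mem_cyclotomicSubfield ?_)
          rw [div_pow, hz, Units.val_pow_eq_pow_val, div_self (pow_ne_zero _ γ.ne_zero)]
        have := mul_mem (hCE _ h1) hγ
        rwa [div_mul_cancel₀ _ γ.ne_zero] at this
      rintro z ((hz | hz) | hz)
      · exact hCE z (hμ z hz)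
      · exact haux z α _ dvd_rfl (by rw [hα]; exact hz) hαE
      · exact haux z β i (Dvd.intro _ rfl) (by rw [hβ]; exact hz) hβE
    · rw [adjoin_le_iff]
      rintro _ ⟨v, rfl⟩
      have : (ψ v : Ω) ∈ R := by
        rw [hψ, Units.val_mul, Units.val_zpow_eq_zpow_val, Units.val_zpow_eq_zpow_val]
        exact mul_mem (zpow_mem hαR _) (zpow_mem hβR _)
      exact this
  have htower : Module.finrank k C * Module.finrank C (extendScalars hCR) = Module.finrank k R :=
    Module.finrank_mul_finrank k C (extendScalars hCR)
  rw [← htower, hext, key, hHi, finrank_cyclotomicSubfield hirr]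

end RadicalLattice

/-! ### Divisibility of the exponents by means of the torsion order -/

/-- Squaring removes the sign; this is where the factor 2 in `2t` comes from. -/
theorem exists_sq_eq_of_mem_signedSpan {a b w : ℚˣ} (hw : w ∈ signedSpan a b) :
    ∃ r s : ℤ, w ^ 2 = a ^ (2 * r) * b ^ (2 * s) := by
  induction hw using Subgroup.closure_induction with
  | mem x hx =>
    rcases hx with rfl | rfl | rfl
    · exact ⟨0, 0, by simp⟩
    · exact ⟨1, 0, by simp⟩
    · exact ⟨0, 1, by simp⟩
  | one => exact ⟨0, 0, by simp⟩
  | mul x y _ _ hx hy =>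
    obtain ⟨r, s, h⟩ := hx
    obtain ⟨r', s', h'⟩ := hy
    exact ⟨r + r', s + s', by
      rw [mul_pow, h, h', mul_add, mul_add, zpow_add, zpow_add, mul_mul_mul_comm]⟩
  | inv x _ hx =>
    obtain ⟨r, s, h⟩ := hx
    exact ⟨-r, -s, by rw [inv_pow, h, mul_neg, mul_neg, zpow_neg, zpow_neg, mul_inv]⟩

/-- Finiteness of the torsion subgroup is not needed: `Nat.card` of an infinite group is `0`, and
the claim is then trivial. -/
theorem pow_torsionOrder_mem {a b u : ℚˣ} {n : ℕ} (hn : 0 < n) (hu : u ^ n ∈ signedSpan a b) :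
    u ^ torsionOrder a b ∈ signedSpan a b := by
  have hfin : IsOfFinOrder (u : ℚˣ ⧸ signedSpan a b) :=
    isOfFinOrder_iff_pow_eq_one.2 ⟨n, hn, (QuotientGroup.eq_one_iff _).2 hu⟩
  have h : (⟨u, hfin⟩ : CommGroup.torsion (ℚˣ ⧸ signedSpan a b)) ^ torsionOrder a b = 1 :=
    pow_card_eq_one'
  exact (QuotientGroup.eq_one_iff _).1 (congrArg Subtype.val h)

theorem MultIndep.zpow_inj {a b : ℚˣ} (hab : MultIndep a b) {x y x' y' : ℤ}
    (h : a ^ x * b ^ y = a ^ x' * b ^ y') : x = x' ∧ y = y' := by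
  have h1 := hab (x - x') (y - y') (by
    rw [zpow_sub, zpow_sub, ← div_eq_mul_inv, ← div_eq_mul_inv, div_mul_div_comm, h, div_self'])
  exact ⟨sub_eq_zero.1 h1.1, sub_eq_zero.1 h1.2⟩

section

variable {Ω : Type*} [Field Ω] [Algebra ℚ Ω] [CharZero Ω] [IsAlgClosed Ω]

theorem exists_pow_eq_sq_of_mem_radicalLattice {a b : ℚˣ} {i j : ℕ} (hi : 0 < i) (hj : 0 < j)
    {v : ℤ × ℤ} (hv : v ∈ radicalLattice ℚ Ω a b i j) :
    ∃ c : ℚˣ, 0 < (c : ℚ) ∧ c ^ (i * j) = (a ^ v.1 * b ^ (j * v.2)) ^ 2 := by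
  obtain ⟨z, hz, hzq⟩ := hv
  have hn := Nat.mul_pos hi hj
  obtain ⟨c, hc⟩ := exists_pow_eq_sq_of_pow_eq
    (fun n hn => Polynomial.cyclotomic.irreducible_rat hn) hn
    (Units.ne_zero (a ^ v.1 * b ^ (j * v.2))) hz (by simpa using congrArg Units.val hzq)
  have hc0 : c ≠ 0 := by
    rintro rfl
    rw [zero_pow hn.ne'] at hc
    exact pow_ne_zero 2 (Units.ne_zero _) hc.symm
  -- `|c|` still works because the right-hand side is a square. Positivity later allows the
  -- extraction of real roots.
  refine ⟨Units.mk0 |c| (abs_ne_zero.2 hc0), abs_pos.2 hc0, Units.ext ?_⟩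
  rw [Units.val_pow_eq_pow_val, Units.val_mk0, ← abs_pow, hc, abs_of_nonneg (sq_nonneg _),
    Units.val_pow_eq_pow_val]

/-- With `c^(ij) = q²`, the class of `c` is torsion, so `c^(2t)` is a product of even powers of `a`
and `b`. Independence allows exponents to be compared in `(c^(2t))^(ij) = q^(4t)`. -/
theorem dvd_of_mem_radicalLattice {a b : ℚˣ} (hab : MultIndep a b) {i j : ℕ} (hi : 0 < i)
    (hj : 0 < j) {v : ℤ × ℤ} (hv : v ∈ radicalLattice ℚ Ω a b i j) :
    ((i * j : ℕ) : ℤ) ∣ (2 * torsionOrder a b : ℕ) * v.1 ∧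
      (i : ℤ) ∣ (2 * torsionOrder a b : ℕ) * v.2 := by
  obtain ⟨c, -, hc⟩ := exists_pow_eq_sq_of_mem_radicalLattice hi hj hv
  have ha : a ∈ signedSpan a b := Subgroup.subset_closure (by simp)
  have hb : b ∈ signedSpan a b := Subgroup.subset_closure (by simp)
  have hct := pow_torsionOrder_mem (Nat.mul_pos hi hj) (a := a) (b := b) (u := c) (by
    rw [hc]
    exact pow_mem (mul_mem (zpow_mem ha _) (zpow_mem hb _)) 2)
  set t := torsionOrder a b
  obtain ⟨r, s, hrs⟩ := exists_sq_eq_of_mem_signedSpan hct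
  have h1 : ((c ^ t) ^ 2) ^ (i * j) = ((c ^ (i * j)) ^ t) ^ 2 := by
    rw [← pow_mul, ← pow_mul, ← pow_mul, ← pow_mul]; congr 1; ring
  rw [hrs, hc] at h1
  rw [mul_pow, ← pow_mul, ← pow_mul, mul_pow] at h1
  simp only [← zpow_natCast, ← zpow_mul] at h1
  obtain ⟨h2, h3⟩ := hab.zpow_inj h1
  push_cast at h2 h3 ⊢
  have hj' : (j : ℤ) ≠ 0 := by exact_mod_cast hj.ne'
  refine ⟨⟨r, by linarith⟩, ⟨s, ?_⟩⟩
  apply mul_left_cancel₀ hj'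
  linarith

/-! ### Square roots of rationals supported on the bad primes -/

theorem padicValRat_ne_zero_of_dvd_num {p : ℕ} (hp : p.Prime) {c : ℚ} (hc : c ≠ 0)
    (h : p ∣ c.num.natAbs) : padicValRat p c ≠ 0 := by
  have : Fact p.Prime := ⟨hp⟩
  have hden : ¬ p ∣ c.den := fun h' => hp.not_dvd_one (c.reduced ▸ Nat.dvd_gcd h h')
  have hnum := one_le_padicValNat_of_dvd (by simpa using hc) h
  rw [padicValRat, padicValInt, padicValNat.eq_zero_of_not_dvd hden, Nat.cast_zero, sub_zero,
    Nat.cast_ne_zero]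
  exact Nat.one_le_iff_ne_zero.1 hnum

theorem badPrimesProd_pos (a b : ℚˣ) : 0 < badPrimesProd a b :=
  Finset.prod_pos fun _ hp => ((badPrimes_finite a b).mem_toFinset.1 hp).1.pos

theorem dvd_badPrimesProd {a b : ℚˣ} {p : ℕ} (hp : p ∈ badPrimes a b) :
    p ∣ badPrimesProd a b :=
  Finset.dvd_prod_of_mem _ ((badPrimes_finite a b).mem_toFinset.2 hp)

theorem exists_sq_eq_natCast {s m : ℕ} (hm : m ≠ 0) (h : ∀ p : ℕ, p.Prime → p ∣ m → p ∣ s) :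
    ∃ w ∈ cyclotomicSubfield ℚ Ω (8 * s), w ^ 2 = (m : Ω) := by
  induction m using Nat.recOnMul with
  | zero => exact absurd rfl hm
  | one => exact ⟨1, one_mem _, by simp⟩
  | prime p hp =>
    obtain ⟨w, hw, hw2⟩ := exists_sq_eq_natCast_of_prime (k := ℚ) (Ω := Ω) hp
    exact ⟨w, cyclotomicSubfield_mono (Nat.mul_dvd_mul_left 8 (h p hp dvd_rfl)) hw, hw2⟩
  | mul m n ihm ihn =>
    obtain ⟨w, hw, hw2⟩ := ihm (left_ne_zero_of_mul hm) fun p hp hd => h p hp (hd.mul_right n)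
    obtain ⟨u, hu, hu2⟩ := ihn (right_ne_zero_of_mul hm) fun p hp hd => h p hp (hd.mul_left m)
    exact ⟨w * u, mul_mem hw hu, by rw [mul_pow, hw2, hu2, Nat.cast_mul]⟩

theorem exists_sq_eq_of_padicValRat {a b : ℚˣ} {c : ℚ} (hc : 0 < c)
    (h : ∀ p : ℕ, p.Prime → p ∉ badPrimes a b → padicValRat p c = 0) :
    ∃ w ∈ cyclotomicSubfield ℚ Ω (8 * badPrimesProd a b), w ^ 2 = algebraMap ℚ Ω c := by
  have key : ∀ c : ℚ, 0 < c → (∀ p : ℕ, p.Prime → p ∉ badPrimes a b → padicValRat p c = 0) →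
      ∀ p : ℕ, p.Prime → p ∣ c.num.natAbs → p ∣ badPrimesProd a b := by
    intro c hc h p hp hd
    by_contra hcon
    exact padicValRat_ne_zero_of_dvd_num hp hc.ne' hd
      (h p hp fun hmem => hcon (dvd_badPrimesProd hmem))
  obtain ⟨w, hw, hw2⟩ := exists_sq_eq_natCast (Ω := Ω) (m := c.num.natAbs)
    (by simpa using hc.ne') (key c hc h)
  -- The denominator of `c` is treated as the numerator of `c⁻¹`.
  obtain ⟨u, hu, hu2⟩ := exists_sq_eq_natCast (Ω := Ω) (m := c⁻¹.num.natAbs)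
    (by simpa using hc.ne') (key c⁻¹ (inv_pos.2 hc) fun p hp hb => by
      have : Fact p.Prime := ⟨hp⟩
      rw [padicValRat.inv, h p hp hb, neg_zero])
  refine ⟨w / u, div_mem hw hu, ?_⟩
  have hden : c⁻¹.num.natAbs = c.den := by
    rw [Rat.num_inv, Int.sign_eq_one_of_pos (Rat.num_pos.2 hc), one_mul, Int.natAbs_natCast]
  have hnum : ((c.num.natAbs : ℕ) : ℚ) = (c.num : ℚ) := by
    rw [Nat.cast_natAbs, abs_of_pos (Rat.num_pos.2 hc)]
  rw [div_pow, hw2, hu2, hden, ← map_natCast (algebraMap ℚ Ω), ← map_natCast (algebraMap ℚ Ω),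
    ← map_div₀, hnum, Rat.num_div_den]

/-! ### Rescaling the lattice -/

/-- Since `e` is odd, `N` carries the full power of 2 in `8st`, which exceeds that in `2t`. -/
theorem even_of_dvd {N e s t : ℕ} (ht : t ≠ 0) (he : Odd e) (hN : N * e = 8 * s * t) {x : ℤ}
    (hx : (N : ℤ) ∣ (2 * t : ℕ) * x) : Even x := by
  obtain ⟨y, hy⟩ := hx
  have hN' : (N : ℤ) * e = 8 * s * t := by exact_mod_cast hN
  have h : (t : ℤ) * (x * e) = t * (2 * (2 * s * y)) := by
    push_cast at hy
    apply mul_left_cancel₀ (two_ne_zero (α := ℤ))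
    linear_combination (e : ℤ) * hy + y * hN'
  have h2 := mul_left_cancel₀ (by exact_mod_cast ht) h
  have h3 : Even (x * e) := ⟨2 * s * y, by rw [h2]; ring⟩
  have he' : ¬ Even (e : ℤ) := by
    rw [Int.even_coe_nat]; exact Nat.not_even_iff_odd.2 he
  exact (Int.even_mul.1 h3).resolve_right he'

/-- With `N = IJ`, the positive rational `c` satisfies `c^N = q₀²`, so `δ = √c` satisfies `δ^N =
±q₀` and lies in `ℚ(ζ_{8s})`. A suitable `N`-th root of `q₀` is placed in two cyclotomic fields
whose intersection is inside `ℚ(ζ_N)`, by coprimality of `m₁` and `e`. -/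
theorem mem_radicalLattice_of_scaled_mem [IsGalois ℚ Ω] {a b : ℚˣ} (hab : MultIndep a b)
    {i j I J m₁ m₂ e : ℕ} (hi : 0 < i) (hj : 0 < j) (hi' : i = m₂ * I)
    (hij : i * j = m₁ * (I * J))
    (hN : I * J * e = 8 * badPrimesProd a b * torsionOrder a b) (hme : m₁.Coprime e)
    {v : ℤ × ℤ} (hv : (m₁ * v.1, m₂ * v.2) ∈ radicalLattice ℚ Ω a b i j) :
    v ∈ radicalLattice ℚ Ω a b I J := by
  have hn : 0 < i * j := Nat.mul_pos hi hj
  have hm₁ : 0 < m₁ := Nat.pos_of_mul_pos_right (hij ▸ hn)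
  have hNpos : 0 < I * J := Nat.pos_of_mul_pos_left (hij ▸ hn)
  have hm₂ : 0 < m₂ := Nat.pos_of_mul_pos_right (hi' ▸ hi)
  have hI : 0 < I := Nat.pos_of_mul_pos_left (hi' ▸ hi)
  have hs := badPrimesProd_pos a b
  have hjJ : j * m₂ = m₁ * J := by
    apply Nat.eq_of_mul_eq_mul_left hI
    calc I * (j * m₂) = (m₂ * I) * j := by ring
      _ = m₁ * (I * J) := by rw [← hi', hij]
      _ = I * (m₁ * J) := by ring
  set q₀ : ℚˣ := a ^ v.1 * b ^ (J * v.2) with hq₀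
  have hq : a ^ (m₁ * v.1) * b ^ (j * (m₂ * v.2)) = q₀ ^ m₁ := by
    have : (j : ℤ) * (m₂ * v.2) = J * v.2 * m₁ := by
      have : (j : ℤ) * m₂ = m₁ * J := by exact_mod_cast hjJ
      linear_combination v.2 * this
    rw [this, hq₀, mul_pow, mul_comm (m₁ : ℤ), zpow_mul, zpow_mul, zpow_natCast, zpow_natCast]
  obtain ⟨hd₁, hd₂⟩ := dvd_of_mem_radicalLattice hab hi hj hv
  obtain ⟨c, hc, hcn⟩ := exists_pow_eq_sq_of_mem_radicalLattice hi hj hv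
  obtain ⟨z, hz, hzn⟩ := hv
  simp only [hq] at hd₁ hd₂ hcn hzn
  have hcN : c ^ (I * J) = q₀ ^ 2 := by
    apply Units.ext
    rw [Units.val_pow_eq_pow_val, Units.val_pow_eq_pow_val]
    have h := congrArg (fun u : ℚˣ => (u : ℚ)) hcn
    simp only [Units.val_pow_eq_pow_val] at h
    rw [← pow_left_inj₀ (pow_nonneg hc.le _) (sq_nonneg _) hm₁.ne', ← pow_mul, ← pow_mul,
      mul_comm _ m₁, ← hij, h, ← pow_mul, mul_comm]
  have hcval : ∀ p : ℕ, p.Prime → p ∉ badPrimes a b → padicValRat p (c : ℚ) = 0 := by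
    intro p hp hpb
    have : Fact p.Prime := ⟨hp⟩
    obtain ⟨ha0, hb0⟩ : padicValRat p (a : ℚ) = 0 ∧ padicValRat p (b : ℚ) = 0 :=
      not_not.1 fun h => hpb ⟨hp, h⟩
    have h := congrArg (fun u : ℚˣ => padicValRat p (u : ℚ)) hcN
    simp only [Units.val_pow_eq_pow_val] at h
    rw [padicValRat.pow, padicValRat.pow, hq₀, Units.val_mul,
      padicValRat.mul (Units.ne_zero _) (Units.ne_zero _), Units.val_zpow_eq_zpow_val,
      Units.val_zpow_eq_zpow_val, padicValRat.zpow, padicValRat.zpow, ha0, hb0] at h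
    simpa [hI.ne', (Nat.pos_of_mul_pos_left hNpos).ne'] using h
  obtain ⟨δ₀, hδ, hδc⟩ := exists_sq_eq_of_padicValRat (Ω := Ω) hc hcval
  have hδ0 : δ₀ ≠ 0 := by
    rintro rfl
    rw [zero_pow two_ne_zero] at hδc
    exact (map_ne_zero (algebraMap ℚ Ω)).2 c.ne_zero hδc.symm
  obtain ⟨δ, rfl⟩ : ∃ δ : Ωˣ, (δ : Ω) = δ₀ := ⟨Units.mk0 δ₀ hδ0, rfl⟩
  set emb : ℚˣ →* Ωˣ := Units.map (algebraMap ℚ Ω : ℚ →* Ω) with hemb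
  have hδ2 : δ ^ 2 = emb c := Units.ext hδc
  have hnN : I * J ∣ i * j := Dvd.intro_left _ hij.symm
  have hdvdn : (8 * badPrimesProd a b).gcd (i * j) ∣ I * J := by
    have h : (8 * badPrimesProd a b).gcd (i * j) ∣ (I * J * e).gcd (I * J * m₁) :=
      Nat.dvd_gcd ((Nat.gcd_dvd_left _ _).trans (hN ▸ Dvd.intro _ rfl))
        ((Nat.gcd_dvd_right _ _).trans (by rw [hij, mul_comm]))
    rwa [Nat.gcd_mul_left, hme.symm.gcd_eq_one, mul_one] at h
  rw [mem_radicalLattice]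
  change ∃ z : Ωˣ, _ ∧ z ^ (I * J) = emb q₀
  change z ^ (i * j) = emb (q₀ ^ m₁) at hzn
  have hroot : ∀ {m : ℕ} {u : Ωˣ}, u ^ m = 1 → (u : Ω) ∈ cyclotomicSubfield ℚ Ω m :=
    fun h => mem_cyclotomicSubfield (by rw [← Units.val_pow_eq_pow_val, h, Units.val_one])
  -- For even `m₁`, `e` is odd; both exponents in `q₀` are then even, so `q₀ > 0` and `δ` itself is
  -- an `N`-th root of `q₀`.
  rcases Nat.even_or_odd m₁ with hm | hm
  · have he : Odd e := by
      rw [← Nat.not_even_iff_odd]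
      intro he
      exact Nat.not_coprime_of_dvd_of_dvd one_lt_two hm.two_dvd he.two_dvd hme
    have ht : torsionOrder a b ≠ 0 := by
      intro ht
      rw [ht, mul_zero] at hN
      rcases Nat.mul_eq_zero.1 hN with h | h
      · exact hNpos.ne' h
      · exact Nat.not_odd_zero (h ▸ he)
    have hd₁' : ((I * J : ℕ) : ℤ) ∣ (2 * torsionOrder a b : ℕ) * v.1 := by
      rw [hij, Nat.cast_mul, mul_left_comm] at hd₁
      exact Int.dvd_of_mul_dvd_mul_left (by exact_mod_cast hm₁.ne') hd₁
    have hd₂' : (I : ℤ) ∣ (2 * torsionOrder a b : ℕ) * v.2 := by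
      rw [hi', Nat.cast_mul, mul_left_comm] at hd₂
      exact Int.dvd_of_mul_dvd_mul_left (by exact_mod_cast hm₂.ne') hd₂
    obtain ⟨x, hx⟩ := even_of_dvd ht he hN hd₁'
    obtain ⟨y, hy⟩ := even_of_dvd ht he hN (x := J * v.2) (by
      rw [mul_left_comm, Nat.cast_mul, mul_comm (I : ℤ)]
      exact mul_dvd_mul_left _ hd₂')
    obtain ⟨M, hM⟩ : Even (I * J) := by
      have : Even (I * J * e) := ⟨4 * badPrimesProd a b * torsionOrder a b, by rw [hN]; ring⟩
      exact (Nat.even_mul.1 this).resolve_right (Nat.not_even_iff_odd.2 he)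
    have hq₀r : q₀ = (a ^ x * b ^ y) ^ 2 := by
      rw [hq₀, hx, hy, zpow_add, zpow_add, mul_mul_mul_comm, ← sq]
    have hcM : c ^ M = q₀ := by
      apply Units.ext
      have hpos : 0 ≤ (q₀ : ℚ) := by
        rw [hq₀r, Units.val_pow_eq_pow_val]
        exact sq_nonneg _
      rw [← pow_left_inj₀ (by rw [Units.val_pow_eq_pow_val]; exact pow_nonneg hc.le _) hpos
        two_ne_zero, ← Units.val_pow_eq_pow_val, ← Units.val_pow_eq_pow_val, ← hcN, hM, ← pow_mul,
        mul_two]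
    have hδN : δ ^ (I * J) = emb q₀ := by
      rw [hM, ← two_mul, pow_mul, hδ2, ← map_pow, hcM]
    have hδn : (δ : Ω) ∈ cyclotomicSubfield ℚ Ω (i * j) := by
      have h : (z / δ) ^ (i * j) = 1 := by
        rw [div_pow, hzn, hij, mul_comm m₁, pow_mul, hδN, map_pow, div_self']
      have := div_mem hz (hroot h)
      rwa [← Units.val_div_eq_div_val, div_div_cancel] at this
    refine ⟨δ, cyclotomicSubfield_mono hdvdn ?_, hδN⟩
    rw [← cyclotomicSubfield_inf (fun n hn => Polynomial.cyclotomic.irreducible_rat hn) _ _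
      (by positivity) hn]
    exact ⟨hδ, hδn⟩
  -- For odd `m₁` the sign `ε` may be `-1`. As `ε^m₁ = ε`, the factor `(z/δ)^m₁` is an `N`-th root
  -- of `ε` and corrects `δ`. It brings in `ζ_{2N}`, which is harmless because `m₁` is also prime to
  -- 2.
  · set ε : Ωˣ := emb q₀ / δ ^ (I * J) with hε
    have hε2 : ε ^ 2 = 1 := by
      rw [hε, div_pow, ← pow_mul, mul_comm, pow_mul, hδ2, ← map_pow, ← map_pow, hcN, div_self']
    obtain ⟨r, hr⟩ := hm
    have hξ : (z / δ) ^ (i * j) = ε := by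
      rw [div_pow, hzn, hij, mul_comm m₁, pow_mul, map_pow, ← div_pow, ← hε, hr, pow_succ, pow_mul,
        hε2, one_pow, one_mul]
    have hξN : ((z / δ) ^ m₁) ^ (I * J) = ε := by rw [← pow_mul, ← hij, hξ]
    have hmem_n : (((z / δ) ^ m₁ * δ : Ωˣ) : Ω) ∈ cyclotomicSubfield ℚ Ω (i * j) := by
      have h1 : ((z / δ) ^ 2) ^ (i * j) = 1 := by rw [← pow_mul, mul_comm, pow_mul, hξ, hε2]
      have h2 : (z / δ) ^ m₁ * δ = ((z / δ) ^ 2) ^ r * z := by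
        rw [hr, pow_succ, pow_mul, mul_assoc, div_mul_cancel]
      rw [h2, Units.val_mul, Units.val_pow_eq_pow_val]
      exact mul_mem (pow_mem (hroot h1) r) hz
    have hmem_lcm : (((z / δ) ^ m₁ * δ : Ωˣ) : Ω) ∈
        cyclotomicSubfield ℚ Ω ((2 * (I * J)).lcm (8 * badPrimesProd a b)) := by
      have h1 : ((z / δ) ^ m₁) ^ (2 * (I * J)) = 1 := by rw [mul_comm, pow_mul, hξN, hε2]
      rw [Units.val_mul]
      exact mul_mem (cyclotomicSubfield_mono (Nat.dvd_lcm_left _ _) (hroot h1))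
        (cyclotomicSubfield_mono (Nat.dvd_lcm_right _ _) hδ)
    refine ⟨(z / δ) ^ m₁ * δ, ?_, by rw [mul_pow, hξN, hε, div_mul_cancel]⟩
    have hdvd : ((2 * (I * J)).lcm (8 * badPrimesProd a b)).gcd (i * j) ∣ I * J := by
      have h : ((2 * (I * J)).lcm (8 * badPrimesProd a b)).gcd (i * j) ∣
          (I * J * (2 * e)).gcd (I * J * m₁) := by
        refine Nat.dvd_gcd ((Nat.gcd_dvd_left _ _).trans (Nat.lcm_dvd ?_ ?_))
          ((Nat.gcd_dvd_right _ _).trans (by rw [hij, mul_comm]))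
        · exact ⟨e, by ring⟩
        · rw [mul_left_comm, hN]
          exact ⟨2 * torsionOrder a b, by ring⟩
      have hco : (2 * e).Coprime m₁ :=
        Nat.Coprime.mul_left (Nat.coprime_two_left.2 ⟨r, hr⟩) hme.symm
      rwa [Nat.gcd_mul_left, hco.gcd_eq_one, mul_one] at h
    refine cyclotomicSubfield_mono hdvd ?_
    rw [← cyclotomicSubfield_inf (fun n hn => Polynomial.cyclotomic.irreducible_rat hn) _ _
      (Nat.lcm_pos (by positivity) (by positivity)) hn]
    exact ⟨hmem_lcm, hmem_n⟩

theorem index_map_scale (m₁ m₂ : ℕ) (hm₁ : m₁ ≠ 0) (hm₂ : m₂ ≠ 0) (H : AddSubgroup (ℤ × ℤ)) :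
    (H.map ((AddMonoidHom.mulLeft (m₁ : ℤ)).prodMap (AddMonoidHom.mulLeft (m₂ : ℤ)))).index =
      H.index * (m₁ * m₂) := by
  rw [AddSubgroup.index_map_of_injective, ← index_prod_zmultiples m₁ m₂]
  · congr 2
    ext ⟨x, y⟩
    simp only [AddMonoidHom.mem_range, AddSubgroup.mem_prod, Int.mem_zmultiples_iff, Prod.exists,
      AddMonoidHom.prodMap, AddMonoidHom.prod_apply, AddMonoidHom.comp_apply,
      AddMonoidHom.coe_fst, AddMonoidHom.coe_snd, AddMonoidHom.coe_mulLeft, Prod.mk.injEq]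
    constructor
    · rintro ⟨u, w, rfl, rfl⟩
      exact ⟨Dvd.intro _ rfl, Dvd.intro _ rfl⟩
    · rintro ⟨⟨u, rfl⟩, ⟨w, rfl⟩⟩
      exact ⟨u, w, rfl, rfl⟩
  · rintro ⟨x, y⟩ ⟨u, w⟩ h
    simpa [hm₁, hm₂] using h

theorem radicalLattice_eq_map [IsGalois ℚ Ω] {a b : ℚˣ} (hab : MultIndep a b)
    {i j I J m₁ m₂ e : ℕ} (hi : 0 < i) (hj : 0 < j) (hi' : i = m₂ * I)
    (hij : i * j = m₁ * (I * J))
    (hN : I * J * e = 8 * badPrimesProd a b * torsionOrder a b) (hme : m₁.Coprime e)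
    (hI : I = i.gcd (2 * torsionOrder a b)) :
    radicalLattice ℚ Ω a b i j = (radicalLattice ℚ Ω a b I J).map
      ((AddMonoidHom.mulLeft (m₁ : ℤ)).prodMap (AddMonoidHom.mulLeft (m₂ : ℤ))) := by
  have hn : 0 < i * j := Nat.mul_pos hi hj
  have hNpos : 0 < I * J := Nat.pos_of_mul_pos_left (hij ▸ hn)
  have hIpos : 0 < I := Nat.pos_of_mul_pos_left (hi' ▸ hi)
  ext ⟨X, Y⟩
  constructor
  · intro hv
    obtain ⟨hd₁, hd₂⟩ := dvd_of_mem_radicalLattice hab hi hj hv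
    -- By Bézout, `m ∣ l x` gives `m ∣ gcd(m, l) x`.
    have hgcd : ∀ {m g l : ℕ} {x : ℤ}, m.gcd l ∣ g → (m : ℤ) ∣ (l : ℤ) * x →
        (m : ℤ) ∣ g * x := by
      intro m g l x hg h
      have h1 : (m : ℤ) ∣ (m.gcd l : ℕ) * x := by
        rw [Nat.gcd_eq_gcd_ab, add_mul, mul_assoc, mul_right_comm]
        exact dvd_add (Dvd.intro _ rfl) (h.mul_right _)
      exact h1.trans (mul_dvd_mul_right (by exact_mod_cast hg) x)
    have hgN : (i * j).gcd (2 * torsionOrder a b) ∣ I * J := by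
      have h : (i * j).gcd (2 * torsionOrder a b) ∣ (I * J * m₁).gcd (I * J * e) :=
        Nat.dvd_gcd ((Nat.gcd_dvd_left _ _).trans (by rw [hij, mul_comm]))
          ((Nat.gcd_dvd_right _ _).trans ⟨4 * badPrimesProd a b, by rw [hN]; ring⟩)
      rwa [Nat.gcd_mul_left, hme.gcd_eq_one, mul_one] at h
    have h₁ := hgcd hgN hd₁
    have h₂ := hgcd hI.symm.dvd hd₂
    rw [hij, Nat.cast_mul m₁, mul_comm (m₁ : ℤ)] at h₁
    rw [hi', Nat.cast_mul, mul_comm (m₂ : ℤ)] at h₂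
    obtain ⟨x, rfl⟩ := Int.dvd_of_mul_dvd_mul_left (by exact_mod_cast hNpos.ne') h₁
    obtain ⟨y, rfl⟩ := Int.dvd_of_mul_dvd_mul_left (by exact_mod_cast hIpos.ne') h₂
    exact ⟨(x, y), mem_radicalLattice_of_scaled_mem hab hi hj hi' hij hN hme hv, rfl⟩
  · rintro ⟨⟨x, y⟩, ⟨z, hz, hzn⟩, h⟩
    obtain ⟨rfl, rfl⟩ : m₁ * x = X ∧ m₂ * y = Y := Prod.mk.inj h
    have hjJ : (j : ℤ) * m₂ = J * m₁ := by
      have : I * (j * m₂) = I * (J * m₁) := by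
        calc I * (j * m₂) = (m₂ * I) * j := by ring
          _ = m₁ * (I * J) := by rw [← hi', hij]
          _ = I * (J * m₁) := by ring
      exact_mod_cast Nat.eq_of_mul_eq_mul_left hIpos this
    refine ⟨z, cyclotomicSubfield_mono (Dvd.intro_left _ hij.symm) hz, ?_⟩
    have hy : (j : ℤ) * (m₂ * y) = J * y * m₁ := by linear_combination y * hjJ
    dsimp only at hzn ⊢
    rw [hij, mul_comm m₁, pow_mul, hzn, ← map_pow, mul_pow, hy, mul_comm (m₁ : ℤ), zpow_mul a,
      zpow_mul b _ (m₁ : ℤ), zpow_natCast, zpow_natCast]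

end

/-! ### Conclusion over `ℚ` -/

theorem isGalois_algebraicClosure_rat : IsGalois ℚ (AlgebraicClosure ℚ) := by
  have h : @IsGalois ℚ _ (AlgebraicClosure ℚ) _ (AlgebraicClosure.instAlgebra ℚ) := inferInstance
  rwa [Subsingleton.elim (AlgebraicClosure.instAlgebra ℚ : Algebra ℚ (AlgebraicClosure ℚ))
    DivisionRing.toRatAlgebra] at h

theorem degreeLoss_eq (a b : ℚˣ) {i j : ℕ} (hi : 0 < i) (hj : 0 < j) :
    degreeLoss a b i j =
      (i * j * i : ℕ) / ((radicalLattice ℚ (AlgebraicClosure ℚ) a b i j).index : ℚ) := by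
  have := isGalois_algebraicClosure_rat
  have h := finrank_adjoin_radicals (Ω := AlgebraicClosure ℚ)
    (fun n hn => Polynomial.cyclotomic.irreducible_rat hn) a b hi hj
  have hφ : (((i * j).totient : ℕ) : ℚ) ≠ 0 :=
    Nat.cast_ne_zero.2 (Nat.totient_pos.2 (Nat.mul_pos hi hj)).ne'
  rw [degreeLoss, radicalField, h, Nat.cast_mul, mul_comm ((i * j).totient : ℚ),
    mul_div_mul_right _ _ hφ]
  push_cast
  ring

end TwoVariableArtin

theorem mainTheorem7 (a b : ℚˣ) (hab : TwoVariableArtin.MultIndep a b) :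
    ∃ g : ℕ → ℕ → ℕ, ∀ i j : ℕ, 0 < i → 0 < j →
      TwoVariableArtin.degreeLoss a b i j =
        (g (Nat.gcd i (2 * TwoVariableArtin.torsionOrder a b))
          (Nat.gcd (i * j)
            (8 * TwoVariableArtin.badPrimesProd a b * TwoVariableArtin.torsionOrder a b)) : ℚ) := by
  open TwoVariableArtin in
  have := isGalois_algebraicClosure_rat
  -- This is `f_{I,J}` with `J = N / I`; both natural-number divisions are exact at the arguments
  -- that occur.
  refine ⟨fun I N => N * I / (radicalLattice ℚ (AlgebraicClosure ℚ) a b I (N / I)).index,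
    fun i j hi hj => ?_⟩
  rw [degreeLoss_eq a b hi hj]
  set t := torsionOrder a b
  set s := badPrimesProd a b
  have hn : 0 < i * j := Nat.mul_pos hi hj
  obtain ⟨J, hJ⟩ : i.gcd (2 * t) ∣ (i * j).gcd (8 * s * t) :=
    Nat.dvd_gcd ((Nat.gcd_dvd_left _ _).trans (Dvd.intro _ rfl))
      ((Nat.gcd_dvd_right _ _).trans ⟨4 * s, by ring⟩)
  -- `m₁` and `e` are the cofactors of `N` in `ij` and `8st`; `N` being their gcd, these are
  -- coprime.
  obtain ⟨m₁, e, hme, hm₁, he⟩ := Nat.exists_coprime (i * j) (8 * s * t)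
  obtain ⟨m₂, hm₂⟩ := Nat.gcd_dvd_left i (2 * t)
  rw [mul_comm] at hm₂
  have hI : 0 < i.gcd (2 * t) := Nat.gcd_pos_of_pos_left _ hi
  rw [hJ] at hm₁ he ⊢
  have hmap := radicalLattice_eq_map (Ω := AlgebraicClosure ℚ) hab hi hj hm₂ hm₁
    (by rw [mul_comm, ← he]) hme rfl
  have hdvd := index_radicalLattice_dvd (Ω := AlgebraicClosure ℚ) a b (i.gcd (2 * t)) J
  have hm₁pos : m₁ ≠ 0 := by rintro rfl; simp [hi.ne', hj.ne'] at hm₁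
  have hm₂pos : m₂ ≠ 0 := by rintro rfl; simp [hi.ne'] at hm₂
  have hm : ((m₁ * m₂ : ℕ) : ℚ) ≠ 0 := Nat.cast_ne_zero.2 (mul_ne_zero hm₁pos hm₂pos)
  have hpos : i.gcd (2 * t) * J * i.gcd (2 * t) ≠ 0 := by
    have : 0 < i.gcd (2 * t) * J := Nat.pos_of_mul_pos_left (hm₁ ▸ hn)
    positivity
  dsimp only
  rw [hmap, index_map_scale m₁ m₂ hm₁pos hm₂pos, Nat.mul_div_cancel_left _ hI,
    Nat.cast_div hdvd (Nat.cast_ne_zero.2 fun h => hpos (Nat.eq_zero_of_zero_dvd (h ▸ hdvd))),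
    Nat.cast_mul _ (m₁ * m₂)]
  rw [show i * j * i = i.gcd (2 * t) * J * i.gcd (2 * t) * (m₁ * m₂) by
    conv_lhs => rw [hm₁]
    conv_lhs => enter [2]; rw [hm₂]
    ring]
  rw [Nat.cast_mul _ (m₁ * m₂), mul_div_mul_right _ _ hm]
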